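/- **Setting.** There are $N$ players. Player $p$ has a non-empty closed convex strategy set $\Omega^p\subseteq\mathbb R^{n_p}$ and a payoff $\mathcal U^p$ that is defined and continuously differentiable on an open set containing $\Omega=\prod_p\Omega^p$ and is concave in $x^p\in\Omega^p$ for all fixed strategies of the other players (a *concave game*). Let $U(x)=(\nabla_{x^p}\,\mathcal U^p(x^p;x^{-p}))_p$ be the pseudo-gradient. A *(globally) mere variationally stable state (VSS)* is a Nash equilibrium $x^\star\in\Omega$ with $U(x)^\top(x-x^\star)\le 0$ for all $x\in\Omega$; one also says that the equilibrium is globally merely VS. "Interior" means: in the relative interior of $\Omega$ (which is the interior whenever that is non-empty). For every $p$ let $\vartheta^p:\mathbb R^{n_p}\to\mathbb R\cup\{\infty\}$ be closed, proper and convex with $\{\vartheta^p<\infty\}=\Omega^p$. For $\epsilon>0$ let $$C_\epsilon(z)=\Big(\operatorname{argmax}_{y^p\in\Omega^p}\big[(y^p)^\top z^p-\epsilon\,\vartheta^p(y^p)\big]\Big)_p .$$ The second-order mirror descent dynamics MD2 with parameters $\alpha,\beta,\gamma,\epsilon>0$ are $$\dot z=\gamma\big(U(x)-\alpha(x-\xi)\big),\qquad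 \dot\xi=\beta(x-\xi),\qquad x=C_\epsilon(z).$$ A *rest state* of MD2 is a point $\bar x\in\Omega$ with $\bar x=C_\epsilon(\bar z)$ for some $\bar z$ and $U(\bar x)^\top(y-\bar x)=0$ for all $y\in\Omega$ (that is, $U(\bar x)=0$ if $\Omega$ has non-empty interior). **Theorem.** Consider a concave game in which every interior Nash equilibrium is globally merely VS, and which has at least one interior mere VSS. Let $\alpha,\beta,\gamma,\epsilon>0$, and let $(z(t),\xi(t))$, $t\ge 0$, be a solution of MD2 with arbitrary initial values, $x(t)=C_\epsilon(z(t))$. (i) Suppose that, for every $p$, $\Omega^p$ has non-empty interior, $\vartheta^p$ is $\mathcal C^2$ on the interior of $\Omega^p$, strictly convex on $\Omega^p$, steep (i.e. $\|\nabla\vartheta^p(u_k)\|\to\infty$ whenever the $u_k$ lie in the interior of $\Omega^p$ and converge to a boundary point of $\Omega^p$) and supercoercive (i.e. $\vartheta^p(x)/\|x\|\to\infty$ as $\|x\|\to\infty$). Then, as $t\to\infty$, $x(t)$ converges to an interior mere VSS. (ii) Suppose that, for every $p$, $\Omega^p$ is compact and $\vartheta^p$ is $\rho_p$-strongly convex for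 some $\rho_p>0$, and that rest states of MD2 on the (relative) boundary of $\Omega$, if there are any, are also globally merely VS. Then, as $t\to\infty$, $x(t)$ converges to a mere VSS that is a rest state of MD2. (In particular, it converges to an interior mere VSS if MD2 has no rest states on the relative boundary.) -/

import Mathlib

open Set Filter Topology

noncomputable section

namespace MirrorDescentGame

/-- `ℝᵏ` with the Euclidean norm and dot product. -/
abbrev E (k : ℕ) := EuclideanSpace ℝ (Fin k)

/-- Profiles `x = (xᵖ)` with `xᵖ ∈ ℝ^{n_p}`. -/
abbrev Profile {N : ℕ} (n : Fin N → ℕ) := (p : Fin N) → E (n p)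

/-- The dot product `xᵀ y = ∑ₚ ⟨xᵖ, yᵖ⟩` of two profiles. -/
def dot {N : ℕ} {n : Fin N → ℕ} (x y : Profile n) : ℝ := ∑ p, inner ℝ (x p) (y p)

/-- An `N`-player (continuous) concave game. Player `p` has the strategy set `Ω p ⊆ ℝ^{n_p}` and
the payoff `payoff p`, of which only the values on an open set containing `∏ₚ Ω p` matter.
The payoff is `C¹` on such an open set and concave in the player's own strategy. -/
structure ConcaveGame (N : ℕ) (n : Fin N → ℕ) where
  Ω : (p : Fin N) → Set (E (n p))
  nonempty : ∀ p, (Ω p).Nonempty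
  closed : ∀ p, IsClosed (Ω p)
  convex : ∀ p, Convex ℝ (Ω p)
  payoff : Fin N → Profile n → ℝ
  smooth : ∀ p, ∃ O : Set (Profile n), IsOpen O ∧ Set.pi univ Ω ⊆ O ∧ ContDiffOn ℝ 1 (payoff p) O
  concave : ∀ p, ∀ x ∈ Set.pi univ Ω,
    ConcaveOn ℝ (Ω p) fun y : E (n p) => payoff p (Function.update x p y)

namespace ConcaveGame

variable {N : ℕ} {n : Fin N → ℕ} (G : ConcaveGame N n)

/-- The set `Ω = ∏ₚ Ω p` of all strategy profiles. -/
def profiles : Set (Profile n) := Set.pi univ G.Ω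

/-- The relative interior of `Ω` (it is the interior of `Ω` whenever the latter is nonempty). -/
def relInterior : Set (Profile n) := intrinsicInterior ℝ G.profiles

/-- The pseudo-gradient `U(x) = (∇_{xᵖ} payoffᵖ(xᵖ; x⁻ᵖ))ₚ`. -/
def pseudoGradient (x : Profile n) : Profile n :=
  fun p => gradient (fun y : E (n p) => G.payoff p (Function.update x p y)) (x p)

/-- Nash equilibria. -/
def IsNash (x : Profile n) : Prop :=
  x ∈ G.profiles ∧ ∀ p, ∀ y ∈ G.Ω p, G.payoff p (Function.update x p y) ≤ G.payoff p x

/-- Globally merely variationally stable states: Nash equilibria `x` with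
`U(y)ᵀ (y - x) ≤ 0` for all `y ∈ Ω`. -/
def IsMereVSS (x : Profile n) : Prop :=
  G.IsNash x ∧ ∀ y ∈ G.profiles, dot (G.pseudoGradient y) (y - x) ≤ 0

end ConcaveGame

/-- `ϑ : ℝᵏ → ℝ ∪ {∞}` is closed, proper and convex with effective domain `Ω`. -/
structure IsRegularizer {k : ℕ} (Ω : Set (E k)) (ϑ : E k → EReal) : Prop where
  closed : IsClosed {q : E k × ℝ | ϑ q.1 ≤ (q.2 : EReal)}
  convex : Convex ℝ {q : E k × ℝ | ϑ q.1 ≤ (q.2 : EReal)}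
  ne_bot : ∀ x, ϑ x ≠ ⊥
  proper : ∃ x, ϑ x < ⊤
  domain : {x | ϑ x < ⊤} = Ω

/-- `ϑ`, with effective domain `Ω`, is of Legendre type: `Ω` has nonempty interior, and `ϑ` is
strictly convex and steep. -/
structure IsLegendre {k : ℕ} (Ω : Set (E k)) (ϑ : E k → EReal) : Prop where
  interior_nonempty : (interior Ω).Nonempty
  strict : StrictConvexOn ℝ Ω fun x => (ϑ x).toReal
  steep : ∀ (u : ℕ → E k) (b : E k), (∀ i, u i ∈ interior Ω) → b ∈ frontier Ω →
    Tendsto u atTop (𝓝 b) →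
      Tendsto (fun i => ‖gradient (fun x => (ϑ x).toReal) (u i)‖) atTop atTop

/-- `ϑ(x) / ‖x‖ → ∞` as `‖x‖ → ∞`. -/
def IsSupercoercive {k : ℕ} (ϑ : E k → EReal) : Prop :=
  ∀ M : ℝ, ∀ᶠ x in Bornology.cobounded (E k), ((M * ‖x‖ : ℝ) : EReal) ≤ ϑ x

/-- The mirror map `z ↦ argmax_{y ∈ Ω} (yᵀ z - ε ϑ(y))`, for `ϑ` with effective domain `Ω`. -/
def mirrorMap {k : ℕ} (Ω : Set (E k)) (ϑ : E k → EReal) (ε : ℝ) (z : E k) : E k :=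
  Classical.epsilon fun x => x ∈ Ω ∧ IsMaxOn (fun y => inner ℝ y z - ε * (ϑ y).toReal) Ω x

namespace ConcaveGame

variable {N : ℕ} {n : Fin N → ℕ} (G : ConcaveGame N n)

/-- The overall mirror map `C_ε(z) = (C_εᵖ(zᵖ))ₚ`. -/
def mirror (ϑ : (p : Fin N) → E (n p) → EReal) (ε : ℝ) (z : Profile n) : Profile n :=
  fun p => mirrorMap (G.Ω p) (ϑ p) ε (z p)

/-- `(z, ξ)` solves the second-order mirror descent dynamics on `[0, ∞)`: with `x = C_ε(z)`,
`z' = γ (U(x) - α (x - ξ))` and `ξ' = β (x - ξ)`. -/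
def IsMD2Solution (ϑ : (p : Fin N) → E (n p) → EReal) (α β γ ε : ℝ)
    (z ξ : ℝ → Profile n) : Prop :=
  ∀ t, 0 ≤ t →
    HasDerivWithinAt z
      (γ • (G.pseudoGradient (G.mirror ϑ ε (z t)) - α • (G.mirror ϑ ε (z t) - ξ t))) (Ici 0) t ∧
    HasDerivWithinAt ξ (β • (G.mirror ϑ ε (z t) - ξ t)) (Ici 0) t

/-- `x` is a rest state of the dynamics: `x = C_ε(z)` for some `z`, and `U(x)` vanishes along `Ω`,
that is, `U(x)ᵀ (y - x) = 0` for all `y ∈ Ω` (which says `U(x) = 0` if `Ω` has interior points). -/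
def IsRestState (ϑ : (p : Fin N) → E (n p) → EReal) (ε : ℝ) (x : Profile n) : Prop :=
  (∃ z, x = G.mirror ϑ ε z) ∧ ∀ y ∈ G.profiles, dot (G.pseudoGradient x) (y - x) = 0

end ConcaveGame

end MirrorDescentGame

end

/-! Fix `x` in `Ω` and combine the Fenchel coupling of `x` and `z` with a multiple of `‖ξ - x‖ ^ 2`.
Along the flow this Lyapunov function has derivative `⟨U(C z), C z - x⟩ - α ‖C z - ξ‖ ^ 2`, hence
decreases whenever `x` is variationally stable. With `x` a relatively interior VSS, it bounds `ξ`
and the part of `z` parallel to `Ω` (`starProjection_dual_bounded`); the remaining part of `z` does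
not affect `C z`. A Barbalat argument gives `C z - ξ → 0` (`tendsto_gap`), so the state eventually
moves slowly. Near a cluster point where `U` had a component along `Ω`, the dual variable would then
drift beyond its bound; thus cluster points are rest states (`inner_nonpos_of_tendsto`). Such a
cluster point `C w` is itself stable. The Lyapunov function relative to it decreases and tends to
`0` along a subsequence, hence the coupling tends to `0` and the whole trajectory converges
(`tendsto_rest`). For the game, a rest state is Nash by concavity, and steepness puts it in the
interior. -/

noncomputable section

namespace MirrorDescentGame

/-! ### Choice maps, conjugates and the Fenchel coupling. -/

section ChoiceMap

variable {H : Type*} [NormedAddCommGroup H] [InnerProductSpace ℝ H]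

/-- `C` is continuous and `C z` is the unique maximiser of `y ↦ ⟨y, z⟩ - f y` on `Ω`. -/
structure IsChoiceMap (Ω : Set H) (f : H → ℝ) (C : H → H) : Prop where
  continuous : Continuous C
  mem : ∀ z, C z ∈ Ω
  le : ∀ z, ∀ y ∈ Ω, inner ℝ y z - f y ≤ inner ℝ (C z) z - f (C z)
  unique : ∀ z, ∀ x ∈ Ω, (∀ y ∈ Ω, inner ℝ y z - f y ≤ inner ℝ x z - f x) → x = C z

/-- The conjugate `ψ z = max_{y ∈ Ω} (⟨y, z⟩ - f y)`, the maximum being attained at `C z`. -/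
def conjugate (f : H → ℝ) (C : H → H) (z : H) : ℝ := inner ℝ (C z) z - f (C z)

/-- The Fenchel coupling `f x + ψ z - ⟨x, z⟩`. -/
def coupling (f : H → ℝ) (C : H → H) (x z : H) : ℝ := f x + conjugate f C z - inner ℝ x z

namespace IsChoiceMap

variable {Ω : Set H} {f : H → ℝ} {C : H → H} (hC : IsChoiceMap Ω f C)
include hC

lemma coupling_nonneg {x : H} (hx : x ∈ Ω) (z : H) : 0 ≤ coupling f C x z := by
  have := hC.le z x hx
  unfold coupling conjugate; linarith

lemma eq_of_coupling_eq_zero {x : H} (hx : x ∈ Ω) {z : H} (h : coupling f C x z = 0) :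
    x = C z := by
  refine hC.unique z x hx fun y hy => ?_
  have := hC.le z y hy
  unfold coupling conjugate at h; linarith

omit hC in
lemma coupling_self (f : H → ℝ) (C : H → H) (z : H) : coupling f C (C z) z = 0 := by
  unfold coupling conjugate; ring

/-- Comparing the two maximisers gives `⟨C z, w - z⟩ ≤ ψ w - ψ z ≤ ⟨C w, w - z⟩`, and continuity of
`C` closes the gap. -/
lemma hasFDerivAt_conjugate (z : H) :
    HasFDerivAt (conjugate f C) (innerSL ℝ (C z)) z := by
  rw [hasFDerivAt_iff_isLittleO, Asymptotics.isLittleO_iff]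
  intro c hc
  have h1 : ∀ᶠ w in 𝓝 z, dist (C w) (C z) < c :=
    (hC.continuous.tendsto z).eventually (Metric.ball_mem_nhds _ hc)
  filter_upwards [h1] with w hw
  rw [dist_eq_norm] at hw
  have h2 := hC.le w (C z) (hC.mem z)
  have h3 := hC.le z (C w) (hC.mem w)
  have h4 : inner ℝ (C w - C z) (w - z) ≤ c * ‖w - z‖ :=
    (real_inner_le_norm _ _).trans (by gcongr)
  simp only [inner_sub_left, inner_sub_right] at h4
  simp only [conjugate, innerSL_apply_apply, inner_sub_right, Real.norm_eq_abs]
  rw [abs_le]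
  constructor <;> nlinarith [norm_nonneg (w - z)]

lemma continuous_coupling (x : H) : Continuous (coupling f C x) := by
  have h : Continuous (conjugate f C) :=
    continuous_iff_continuousAt.2 fun z => (hC.hasFDerivAt_conjugate z).continuousAt
  unfold coupling
  fun_prop

lemma inner_le_coupling {x y : H} (hy : y ∈ Ω) (z : H) :
    inner ℝ (y - x) z ≤ coupling f C x z + f y - f x := by
  have := hC.le z y hy
  rw [inner_sub_left]
  unfold coupling conjugate; linarith

section Projection

variable [(vectorSpan ℝ Ω).HasOrthogonalProjection]

omit hC in
lemma inner_sub_starProjection {x y : H} (hx : x ∈ Ω) (hy : y ∈ Ω) (z : H) :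
    inner ℝ (y - x) ((vectorSpan ℝ Ω).starProjection z) = inner ℝ (y - x) z := by
  have hv : y - x ∈ vectorSpan ℝ Ω := vsub_mem_vectorSpan ℝ hy hx
  rw [← Submodule.inner_starProjection_left_eq_right,
    Submodule.starProjection_eq_self_iff.2 hv]

/-- A component of `z` orthogonal to `Ω` adds a constant to the objective on `Ω`. The flow need not
control it, so compactness arguments use the projected dual variable. -/
lemma apply_starProjection (z : H) : C ((vectorSpan ℝ Ω).starProjection z) = C z := by
  refine hC.unique z _ (hC.mem _) fun y hy => ?_
  have h1 := hC.le ((vectorSpan ℝ Ω).starProjection z) y hy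
  have h2 := inner_sub_starProjection (hC.mem ((vectorSpan ℝ Ω).starProjection z)) hy z
  simp only [inner_sub_left] at h2
  linarith

lemma coupling_starProjection {x : H} (hx : x ∈ Ω) (z : H) :
    coupling f C x ((vectorSpan ℝ Ω).starProjection z) = coupling f C x z := by
  have h2 := inner_sub_starProjection hx (hC.mem z) z
  simp only [inner_sub_left] at h2
  unfold coupling conjugate
  rw [hC.apply_starProjection]
  linarith

end Projection

end IsChoiceMap

/-- A relative interior point of `Ω` can be moved in every direction of its affine span. -/
lemma exists_pos_add_smul_mem_of_mem_intrinsicInterior {V : Type*} [NormedAddCommGroup V]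
    [NormedSpace ℝ V] {Ω : Set V} {x v : V}
    (hx : x ∈ intrinsicInterior ℝ Ω) (hv : v ∈ vectorSpan ℝ Ω) :
    ∃ s : ℝ, 0 < s ∧ x + s • v ∈ Ω := by
  obtain ⟨a, ha, rfl⟩ := hx
  have hv' : v ∈ (affineSpan ℝ Ω).direction := by rwa [direction_affineSpan]
  let g : ℝ → affineSpan ℝ Ω := fun s =>
    ⟨(s • v) +ᵥ (a : V), AffineSubspace.vadd_mem_of_mem_direction
      (Submodule.smul_mem _ s hv') a.2⟩
  have hg : Continuous g := by
    apply Continuous.subtype_mk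
    simp only [vadd_eq_add]
    fun_prop
  have hg0 : g 0 = a := by ext; simp [g]
  have h1 : ∀ᶠ s in 𝓝 (0 : ℝ), g s ∈ ((↑) ⁻¹' Ω : Set (affineSpan ℝ Ω)) := by
    apply hg.tendsto 0
    rw [hg0]
    exact mem_interior_iff_mem_nhds.1 ha
  obtain ⟨s, hs, hs0⟩ := ((h1.filter_mono nhdsWithin_le_nhds).and
    (self_mem_nhdsWithin : Ioi (0 : ℝ) ∈ 𝓝[>] 0)).exists
  exact ⟨s, hs0, by simpa [g, add_comm] using hs⟩

end ChoiceMap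

/-! ### The Lyapunov function and the bounds it yields. -/

section Flow

variable {H : Type*} [NormedAddCommGroup H] [InnerProductSpace ℝ H]

/-- Mean value inequality on a subinterval of `[0, ∞)`. -/
lemma sub_le_mul_sub_of_hasDerivWithinAt_le {v v' : ℝ → ℝ}
    (hv : ∀ t, 0 ≤ t → HasDerivWithinAt v (v' t) (Ici 0) t) {s t c : ℝ} (hs : 0 ≤ s)
    (hst : s ≤ t) (hc : ∀ u ∈ Icc s t, v' u ≤ c) : v t - v s ≤ c * (t - s) := by
  have hd : ∀ u, HasDerivAt (fun u => v s + c * (u - s)) c u := fun u => by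
    simpa using (((hasDerivAt_id u).sub_const s).const_mul c).const_add (v s)
  have h := image_le_of_deriv_right_le_deriv_boundary (f := v) (f' := v') (a := s) (b := t)
    (B := fun u => v s + c * (u - s)) (B' := fun _ => c)
    (fun u hu => ((hv u (hs.trans hu.1)).continuousWithinAt).mono
      (fun w hw => hs.trans hw.1))
    (fun u hu => (hv u (hs.trans hu.1)).mono (Ici_subset_Ici.2 (hs.trans hu.1)))
    (by simp) (fun u _ => (hd u).continuousAt.continuousWithinAt)
    (fun u _ => (hd u).hasDerivWithinAt) (fun u hu => hc u ⟨hu.1, hu.2.le⟩)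
    (right_mem_Icc.2 hst)
  linarith

/-- `z' = γ (U(x) - α (x - ξ))` and `ξ' = β (x - ξ)` on `[0, ∞)`, where `x = C(z)`. -/
structure IsMirrorFlow (C U : H → H) (α β γ : ℝ) (z ξ : ℝ → H) : Prop where
  deriv_dual : ∀ t, 0 ≤ t →
    HasDerivWithinAt z (γ • (U (C (z t)) - α • (C (z t) - ξ t))) (Ici 0) t
  deriv_aux : ∀ t, 0 ≤ t → HasDerivWithinAt ξ (β • (C (z t) - ξ t)) (Ici 0) t

/-- The Lyapunov function of the flow relative to the point `x`. -/
def lyapunov (f : H → ℝ) (C : H → H) (α β γ : ℝ) (x z ξ : H) : ℝ :=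
  γ⁻¹ * coupling f C x z + α / (2 * β) * ‖ξ - x‖ ^ 2

namespace IsMirrorFlow

variable {Ω : Set H} {f : H → ℝ} {C U : H → H} {α β γ : ℝ} {z ξ : ℝ → H}

lemma hasDerivWithinAt_inner (hF : IsMirrorFlow C U α β γ z ξ) (v : H) {t : ℝ} (ht : 0 ≤ t) :
    HasDerivWithinAt (fun t => inner ℝ v (z t))
      (γ * (inner ℝ v (U (C (z t))) - α * inner ℝ v (C (z t) - ξ t))) (Ici 0) t := by
  have h := (innerSL ℝ v).hasFDerivAt.comp_hasDerivWithinAt t (hF.deriv_dual t ht)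
  refine (h.congr_deriv ?_).congr (fun _ _ => rfl) rfl
  simp [inner_sub_right, inner_smul_right]

lemma hasDerivWithinAt_lyapunov (hC : IsChoiceMap Ω f C) (hF : IsMirrorFlow C U α β γ z ξ)
    (hβ : 0 < β) (hγ : 0 < γ) (x : H) {t : ℝ} (ht : 0 ≤ t) :
    HasDerivWithinAt (fun t => lyapunov f C α β γ x (z t) (ξ t))
      (inner ℝ (U (C (z t))) (C (z t) - x) - α * ‖C (z t) - ξ t‖ ^ 2) (Ici 0) t := by
  have h1 := (hC.hasFDerivAt_conjugate (z t)).comp_hasDerivWithinAt t (hF.deriv_dual t ht)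
  have h2 := hF.hasDerivWithinAt_inner x ht
  have h3 := ((hF.deriv_aux t ht).sub_const x).norm_sq
  have h4 := (((h1.const_add (f x)).sub h2).const_mul γ⁻¹).add (h3.const_mul (α / (2 * β)))
  refine (h4.congr_deriv ?_).congr (fun _ _ => rfl) rfl
  -- The weight `α / (2 * β)` makes the first part cancel the damping term of `z'`; the second
  -- leaves `-α ‖C z - ξ‖ ^ 2`.
  have e1 : ξ t - x = (C (z t) - x) - (C (z t) - ξ t) := by abel
  simp only [innerSL_apply_apply, inner_smul_right, inner_sub_right, e1, inner_sub_left,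
    ← real_inner_self_eq_norm_sq, real_inner_comm (C (z t)) (ξ t),
    real_inner_comm (C (z t)) x, real_inner_comm (U (C (z t))) x,
    real_inner_comm (U (C (z t))) (C (z t)), real_inner_comm (ξ t) x]
  field_simp
  ring

variable (hC : IsChoiceMap Ω f C) (hF : IsMirrorFlow C U α β γ z ξ)
  (hα : 0 < α) (hβ : 0 < β) (hγ : 0 < γ)
include hC hF hα hβ hγ

lemma lyapunov_le {x : H} (hVS : ∀ y ∈ Ω, inner ℝ (U y) (y - x) ≤ 0) {s t : ℝ} (hs : 0 ≤ s)
    (hst : s ≤ t) :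
    lyapunov f C α β γ x (z t) (ξ t) ≤ lyapunov f C α β γ x (z s) (ξ s) := by
  have h := sub_le_mul_sub_of_hasDerivWithinAt_le (c := 0)
    (fun t ht => hF.hasDerivWithinAt_lyapunov hC hβ hγ x ht) hs hst fun u _ => by
      have := hVS _ (hC.mem (z u))
      have : 0 ≤ α * ‖C (z u) - ξ u‖ ^ 2 := by positivity
      linarith
  linarith

omit hC hF in
lemma coupling_le_lyapunov (x z ξ : H) :
    coupling f C x z ≤ γ * lyapunov f C α β γ x z ξ := by
  have h : 0 ≤ γ * (α / (2 * β) * ‖ξ - x‖ ^ 2) := by positivity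
  unfold lyapunov
  rw [mul_add, mul_inv_cancel_left₀ hγ.ne']
  linarith

omit hF in
lemma sq_norm_le_lyapunov {x : H} (hx : x ∈ Ω) (z ξ : H) :
    ‖ξ - x‖ ^ 2 ≤ 2 * β / α * lyapunov f C α β γ x z ξ := by
  have h : 0 ≤ 2 * β / α * (γ⁻¹ * coupling f C x z) := by
    have := hC.coupling_nonneg hx z
    positivity
  have e : 2 * β / α * (α / (2 * β) * ‖ξ - x‖ ^ 2) = ‖ξ - x‖ ^ 2 := by field_simp
  unfold lyapunov
  rw [mul_add, e]
  linarith

omit hF in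
lemma lyapunov_nonneg {x : H} (hx : x ∈ Ω) (z ξ : H) : 0 ≤ lyapunov f C α β γ x z ξ := by
  have := hC.coupling_nonneg hx z
  unfold lyapunov
  positivity

/-- A bounded coupling bounds `⟨y - x, z⟩` for each `y ∈ Ω`; interiority lets `y - x` be a positive
multiple of `v`. Using `-v` as well gives two-sided bounds. -/
lemma inner_dual_bounded {x v : H} (hx : ∀ v ∈ vectorSpan ℝ Ω, ∃ s : ℝ, 0 < s ∧ x + s • v ∈ Ω)
    (hVS : ∀ y ∈ Ω, inner ℝ (U y) (y - x) ≤ 0) (hv : v ∈ vectorSpan ℝ Ω) :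
    ∃ B, ∀ t, 0 ≤ t → inner ℝ v (z t) ≤ B := by
  obtain ⟨s, hs, hsv⟩ := hx v hv
  refine ⟨(γ * lyapunov f C α β γ x (z 0) (ξ 0) + f (x + s • v) - f x) / s, fun t ht => ?_⟩
  have h1 := hC.inner_le_coupling (x := x) hsv (z t)
  have h2 := coupling_le_lyapunov (f := f) (C := C) hα hβ hγ x (z t) (ξ t)
  have h3 := mul_le_mul_of_nonneg_left (hF.lyapunov_le hC hα hβ hγ hVS le_rfl ht) hγ.le
  rw [add_sub_cancel_left, inner_smul_left] at h1
  rw [le_div_iff₀ hs, mul_comm]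
  simp only [conj_trivial] at h1
  linarith

lemma aux_bounded {x : H} (hx : x ∈ Ω) (hVS : ∀ y ∈ Ω, inner ℝ (U y) (y - x) ≤ 0) :
    ∃ B, ∀ t, 0 ≤ t → ‖ξ t‖ ≤ B := by
  refine ⟨√(2 * β / α * lyapunov f C α β γ x (z 0) (ξ 0)) + ‖x‖, fun t ht => ?_⟩
  have h1 := sq_norm_le_lyapunov hC hα hβ hγ hx (z t) (ξ t)
  have h3 := mul_le_mul_of_nonneg_left (hF.lyapunov_le hC hα hβ hγ hVS le_rfl ht)
    (show 0 ≤ 2 * β / α by positivity)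
  have h4 := Real.le_sqrt_of_sq_le (h1.trans h3)
  have h5 := norm_add_le (ξ t - x) x
  rw [sub_add_cancel] at h5
  linarith

lemma starProjection_dual_bounded [CompleteSpace (vectorSpan ℝ Ω)] {x : H}
    (hx : ∀ v ∈ vectorSpan ℝ Ω, ∃ s : ℝ, 0 < s ∧ x + s • v ∈ Ω)
    (hVS : ∀ y ∈ Ω, inner ℝ (U y) (y - x) ≤ 0) :
    ∃ R, ∀ t, 0 ≤ t → ‖(vectorSpan ℝ Ω).starProjection (z t)‖ ≤ R := by
  -- The projected dual variable viewed as a functional: bounds direction by direction become a norm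
  -- bound by uniform boundedness.
  let g : Ici (0 : ℝ) → vectorSpan ℝ Ω →L[ℝ] ℝ := fun t =>
    innerSL ℝ ((vectorSpan ℝ Ω).orthogonalProjectionOnto (z t))
  have hg : ∀ t w, g t w = inner ℝ (w : H) (z t) := fun t w => by
    simp [g, real_inner_comm]
  obtain ⟨R, hR⟩ := banach_steinhaus (g := g) fun v => by
    obtain ⟨B, hB⟩ := hF.inner_dual_bounded hC hα hβ hγ hx hVS v.2
    obtain ⟨B', hB'⟩ := hF.inner_dual_bounded hC hα hβ hγ hx hVS (neg_mem v.2)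
    refine ⟨max B B', fun t => ?_⟩
    have h2 := hB' t t.2
    rw [inner_neg_left] at h2
    rw [hg, Real.norm_eq_abs, abs_le]
    exact ⟨by linarith [le_max_right B B'], (hB t t.2).trans (le_max_left _ _)⟩
  refine ⟨R, fun t ht => ?_⟩
  have := hR ⟨t, ht⟩
  simpa [g] using this

end IsMirrorFlow
end Flow

/-! ### Vanishing gap, rest points and convergence. -/

section Flow

variable {H : Type*} [NormedAddCommGroup H] [InnerProductSpace ℝ H]

namespace IsMirrorFlow

variable {Ω : Set H} {f : H → ℝ} {C U : H → H} {α β γ : ℝ} {z ξ : ℝ → H}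

/-- Bounded velocities make `z` and `ξ` Lipschitz, and `C` is uniformly continuous on the compact
ball containing the projected dual variable. -/
lemma uniformContinuousOn_gap [FiniteDimensional ℝ H] (hC : IsChoiceMap Ω f C)
    (hF : IsMirrorFlow C U α β γ z ξ) (hU : ContinuousOn U Ω) {R B : ℝ}
    (hR : ∀ t, 0 ≤ t → ‖(vectorSpan ℝ Ω).starProjection (z t)‖ ≤ R)
    (hB : ∀ t, 0 ≤ t → ‖ξ t‖ ≤ B) :
    UniformContinuousOn (fun t => C (z t) - ξ t) (Ici 0) := by
  set P := (vectorSpan ℝ Ω).starProjection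
  have hK : IsCompact (Metric.closedBall (0 : H) R) := isCompact_closedBall _ _
  have hx : ∀ t, C (P (z t)) = C (z t) := fun t => hC.apply_starProjection (z t)
  have hmem : ∀ t, 0 ≤ t → P (z t) ∈ Metric.closedBall (0 : H) R := fun t ht => by
    simpa using hR t ht
  obtain ⟨B₁, hB₁⟩ := (hK.image hC.continuous).isBounded.exists_norm_le
  obtain ⟨B₂, hB₂⟩ := ((hK.image hC.continuous).image_of_continuousOn
    (hU.mono (image_subset_iff.2 fun z _ => hC.mem z))).isBounded.exists_norm_le
  have hx₁ : ∀ t, 0 ≤ t → ‖C (z t)‖ ≤ B₁ := fun t ht =>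
    hB₁ _ ⟨_, hmem t ht, hx t⟩
  have hx₂ : ∀ t, 0 ≤ t → ‖U (C (z t))‖ ≤ B₂ := fun t ht =>
    hB₂ _ ⟨_, ⟨_, hmem t ht, hx t⟩, rfl⟩
  have hgap : ∀ t, 0 ≤ t → ‖C (z t) - ξ t‖ ≤ B₁ + B := fun t ht =>
    (norm_sub_le _ _).trans (add_le_add (hx₁ t ht) (hB t ht))
  have hz : UniformContinuousOn z (Ici 0) := by
    refine ((convex_Ici 0).lipschitzOnWith_of_nnnorm_hasDerivWithin_le
      (C := (‖γ‖ * (B₂ + ‖α‖ * (B₁ + B))).toNNReal) hF.deriv_dual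
      fun t ht => ?_).uniformContinuousOn
    rw [← NNReal.coe_le_coe, coe_nnnorm]
    refine le_trans ?_ (Real.le_coe_toNNReal _)
    rw [norm_smul]
    gcongr
    refine (norm_sub_le _ _).trans (add_le_add (hx₂ t ht) ?_)
    rw [norm_smul]
    gcongr
    exact hgap t ht
  have hξ : UniformContinuousOn ξ (Ici 0) := by
    refine ((convex_Ici 0).lipschitzOnWith_of_nnnorm_hasDerivWithin_le
      (C := (‖β‖ * (B₁ + B)).toNNReal) hF.deriv_aux fun t ht => ?_).uniformContinuousOn
    rw [← NNReal.coe_le_coe, coe_nnnorm]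
    refine le_trans ?_ (Real.le_coe_toNNReal _)
    rw [norm_smul]
    gcongr
    exact hgap t ht
  have hPz : UniformContinuousOn (fun t => P (z t)) (Ici 0) :=
    P.uniformContinuous.comp_uniformContinuousOn hz
  have hCx : UniformContinuousOn (fun t => C (P (z t))) (Ici 0) :=
    (hK.uniformContinuousOn_of_continuous hC.continuous.continuousOn).comp hPz hmem
  simp only [hx] at hCx
  rw [uniformContinuousOn_iff_restrict] at hCx hξ ⊢
  exact hCx.sub hξ

/-- A Barbalat argument: the gap between the state and the auxiliary variable vanishes. -/
lemma tendsto_gap (hC : IsChoiceMap Ω f C) (hF : IsMirrorFlow C U α β γ z ξ)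
    (hα : 0 < α) (hβ : 0 < β) (hγ : 0 < γ) {x : H} (hx : x ∈ Ω)
    (hVS : ∀ y ∈ Ω, inner ℝ (U y) (y - x) ≤ 0)
    (hu : UniformContinuousOn (fun t => C (z t) - ξ t) (Ici 0)) :
    Tendsto (fun t => C (z t) - ξ t) atTop (𝓝 0) := by
  rw [Metric.tendsto_atTop]
  intro η hη
  obtain ⟨δ, hδ, hd⟩ := Metric.uniformContinuousOn_iff.1 hu (η / 2) (half_pos hη)
  set L := fun t => lyapunov f C α β γ x (z t) (ξ t)
  -- A gap of size `η` stays above `η / 2` for time `δ / 2`, which costs a fixed amount of `L`.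
  have hdec : ∀ t, 0 ≤ t → η ≤ ‖C (z t) - ξ t‖ →
      L (t + δ / 2) - L t ≤ - (α * (η / 2) ^ 2) * (δ / 2) := fun t ht hbig => by
    have h := sub_le_mul_sub_of_hasDerivWithinAt_le (c := - (α * (η / 2) ^ 2))
      (fun t ht => hF.hasDerivWithinAt_lyapunov hC hβ hγ x ht) ht
      (show t ≤ t + δ / 2 by linarith) fun u hu => by
        have h1 := hVS _ (hC.mem (z u))
        have h2 := hd t ht u (ht.trans hu.1) (by
          rw [Real.dist_eq, abs_lt]; constructor <;> linarith [hu.1, hu.2])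
        rw [dist_eq_norm] at h2
        have h3 : η / 2 ≤ ‖C (z u) - ξ u‖ := by
          have := norm_sub_norm_le (C (z t) - ξ t) (C (z u) - ξ u)
          linarith
        have h4 : α * (η / 2) ^ 2 ≤ α * ‖C (z u) - ξ u‖ ^ 2 := by gcongr
        linarith
    simpa using h
  have hanti : AntitoneOn L (Ici 0) := fun s hs t _ hst =>
    hF.lyapunov_le hC hα hβ hγ hVS hs hst
  -- From `t₀` on, `L` is too close to its infimum to lose that amount.
  have hinf : ∃ t₀, 0 ≤ t₀ ∧ ∀ t, 0 ≤ t → L t₀ < L t + α * (η / 2) ^ 2 * (δ / 2) := by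
    have hbdd : BddBelow (L '' Ici 0) :=
      ⟨0, by rintro _ ⟨t, _, rfl⟩; exact lyapunov_nonneg hC hα hβ hγ hx _ _⟩
    have hpos : 0 < α * (η / 2) ^ 2 * (δ / 2) := by positivity
    obtain ⟨_, ⟨t₀, ht₀, rfl⟩, hlt⟩ := exists_lt_of_csInf_lt
      (nonempty_Ici.image L) (lt_add_of_pos_right (sInf (L '' Ici 0)) hpos)
    exact ⟨t₀, ht₀, fun t ht => by linarith [csInf_le hbdd (mem_image_of_mem L ht)]⟩
  obtain ⟨t₀, ht₀, hlt⟩ := hinf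
  refine ⟨t₀, fun t ht => ?_⟩
  rw [dist_zero_right]
  by_contra! hbig
  have h1 := hdec t (ht₀.trans ht) hbig
  have h2 := hlt (t + δ / 2) (by linarith)
  have h3 := hanti ht₀ (ht₀.trans ht) ht
  linarith

/-- If the gap vanishes, `U` has no component, at a cluster point of the state, along a direction
in which the dual variable stays bounded. -/
lemma inner_nonpos_of_tendsto (hC : IsChoiceMap Ω f C) (hF : IsMirrorFlow C U α β γ z ξ)
    (hβ : 0 < β) (hγ : 0 < γ) (hU : ContinuousOn U Ω)
    (hgap : Tendsto (fun t => C (z t) - ξ t) atTop (𝓝 0)) {τ : ℕ → ℝ}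
    (hτ : Tendsto τ atTop atTop) {x v : H} (hx : x ∈ Ω)
    (hτx : Tendsto (fun k => C (z (τ k))) atTop (𝓝 x)) {B : ℝ}
    (hB : ∀ t, 0 ≤ t → |inner ℝ v (z t)| ≤ B) : inner ℝ (U x) v ≤ 0 := by
  by_contra! hpos
  set c := inner ℝ (U x) v with hc
  have hB0 : 0 ≤ B := (abs_nonneg _).trans (hB 0 le_rfl)
  -- near `x`, and for a small gap, the speed of `⟨v, z⟩` is at least `γ c / 2`
  have hspeed : ∀ᶠ q : H × H in 𝓝[Ω] x ×ˢ 𝓝 0,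
      c / 2 < inner ℝ v (U q.1) - α * inner ℝ v q.2 := by
    have h : Tendsto (fun q : H × H => inner ℝ v (U q.1) - α * inner ℝ v q.2)
        (𝓝[Ω] x ×ˢ 𝓝 0) (𝓝 (inner ℝ v (U x) - α * inner ℝ v (0 : H))) :=
      (tendsto_const_nhds.inner ((hU x hx).tendsto.comp tendsto_fst)).sub
        ((tendsto_const_nhds.inner tendsto_snd).const_mul α)
    refine h.eventually (lt_mem_nhds ?_)
    rw [inner_zero_right, mul_zero, sub_zero, real_inner_comm, ← hc]
    linarith
  obtain ⟨p, hp, q, hq, hpq⟩ := eventually_prod_iff.1 hspeed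
  obtain ⟨r, hr, hrp⟩ := Metric.mem_nhdsWithin_iff.1 hp
  -- Over time `T`, drift at speed `γ c / 2` totals `2 * B + 1`, more than the bound `B` permits.
  set T := (2 * B + 1) / (γ * (c / 2)) with hT
  have hT0 : 0 < T := by positivity
  -- Chosen so that the gap at both ends, the initial distance to `x` (each below `δ`) and the drift
  -- `β * δ * T` of `ξ` together stay below `r`.
  set δ := r / (4 * (1 + β * T)) with hδ
  have hδ0 : 0 < δ := by positivity
  have hδr : 3 * δ + β * δ * T < r := by
    have : r = 4 * δ + 4 * (β * δ * T) := by rw [hδ]; field_simp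
    have : 0 < β * δ * T := by positivity
    linarith
  obtain ⟨t₁, ht₁⟩ := eventually_atTop.1
    ((hgap.eventually hq).and (hgap.eventually (Metric.ball_mem_nhds _ hδ0)))
  obtain ⟨k, hk₁, hk₂⟩ := ((hτ.eventually_ge_atTop (max 0 t₁)).and
    (hτx.eventually (Metric.ball_mem_nhds _ hδ0))).exists
  set s := τ k
  have hs0 : 0 ≤ s := (le_max_left _ _).trans hk₁
  have hs1 : t₁ ≤ s := (le_max_right _ _).trans hk₁
  have hsmall : ∀ u, s ≤ u → ‖C (z u) - ξ u‖ < δ := fun u hu => by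
    simpa using (ht₁ u (hs1.trans hu)).2
  have hclose : ∀ u ∈ Icc s (s + T), C (z u) ∈ Metric.ball x r := fun u hu => by
    have h1 : ‖ξ u - ξ s‖ ≤ β * δ * ‖u - s‖ := by
      refine (convex_Icc s (s + T)).norm_image_sub_le_of_norm_hasDerivWithin_le
        (fun w hw => (hF.deriv_aux w (hs0.trans hw.1)).mono fun y hy => hs0.trans hy.1)
        (fun w hw => ?_) ⟨le_rfl, by linarith⟩ hu
      rw [norm_smul, Real.norm_of_nonneg hβ.le]
      exact mul_le_mul_of_nonneg_left (hsmall w hw.1).le hβ.le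
    have h2 : ‖u - s‖ ≤ T := by
      rw [Real.norm_of_nonneg (by linarith [hu.1])]; linarith [hu.2]
    have h3 : β * δ * ‖u - s‖ ≤ β * δ * T := by gcongr
    have h4 := hsmall u hu.1
    have h5 := hsmall s le_rfl
    have h6 : ‖C (z s) - x‖ < δ := by simpa [dist_eq_norm] using hk₂
    have e : C (z u) - x = (C (z u) - ξ u) + (ξ u - ξ s) - (C (z s) - ξ s) + (C (z s) - x) := by
      abel
    rw [Metric.mem_ball, dist_eq_norm, e]
    have h7 := norm_add_le ((C (z u) - ξ u) + (ξ u - ξ s) - (C (z s) - ξ s)) (C (z s) - x)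
    have h8 := norm_sub_le ((C (z u) - ξ u) + (ξ u - ξ s)) (C (z s) - ξ s)
    have h9 := norm_add_le (C (z u) - ξ u) (ξ u - ξ s)
    linarith
  have hv : ∀ t, 0 ≤ t → HasDerivWithinAt (fun t => - inner ℝ v (z t))
      (-(γ * (inner ℝ v (U (C (z t))) - α * inner ℝ v (C (z t) - ξ t)))) (Ici 0) t :=
    fun t ht => (hF.hasDerivWithinAt_inner v ht).neg
  have h := sub_le_mul_sub_of_hasDerivWithinAt_le (c := -(γ * (c / 2))) hv hs0
    (show s ≤ s + T by linarith) fun u hu => by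
      have := hpq (hrp ⟨hclose u hu, hC.mem _⟩) (ht₁ u (hs1.trans hu.1)).1
      exact neg_le_neg (mul_le_mul_of_nonneg_left this.le hγ.le)
  have e : γ * (c / 2) * T = 2 * B + 1 := by rw [hT]; field_simp
  have h1 := (abs_le.1 (hB s hs0)).1
  have h2 := (abs_le.1 (hB (s + T) (by linarith))).2
  rw [add_sub_cancel_left] at h
  linarith

/-- Convergence of the flow, if `U` is variationally stable at some relative interior point and
at every rest point. -/
theorem tendsto_rest [FiniteDimensional ℝ H] (hC : IsChoiceMap Ω f C)
    (hF : IsMirrorFlow C U α β γ z ξ) (hα : 0 < α) (hβ : 0 < β) (hγ : 0 < γ)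
    (hU : ContinuousOn U Ω) {xs : H} (hxs : xs ∈ Ω)
    (hint : ∀ v ∈ vectorSpan ℝ Ω, ∃ s : ℝ, 0 < s ∧ xs + s • v ∈ Ω)
    (hVS : ∀ y ∈ Ω, inner ℝ (U y) (y - xs) ≤ 0)
    (hrest : ∀ w, (∀ y ∈ Ω, inner ℝ (U (C w)) (y - C w) = 0) →
      ∀ y ∈ Ω, inner ℝ (U y) (y - C w) ≤ 0) :
    ∃ w, (∀ y ∈ Ω, inner ℝ (U (C w)) (y - C w) = 0) ∧
      Tendsto (fun t => C (z t)) atTop (𝓝 (C w)) := by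
  obtain ⟨R, hR⟩ := hF.starProjection_dual_bounded hC hα hβ hγ hint hVS
  obtain ⟨B, hB⟩ := hF.aux_bounded hC hα hβ hγ hxs hVS
  have hgap := hF.tendsto_gap hC hα hβ hγ hxs hVS (hF.uniformContinuousOn_gap hC hU hR hB)
  set P := (vectorSpan ℝ Ω).starProjection
  have hK : IsCompact (Metric.closedBall (0 : H) R) := isCompact_closedBall _ _
  have hCP : ∀ t, C (P (z t)) = C (z t) := fun t => hC.apply_starProjection (z t)
  have hmem : ∀ t, 0 ≤ t → P (z t) ∈ Metric.closedBall (0 : H) R := fun t ht => by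
    simpa using hR t ht
  -- The cluster point is taken in the dual space: the coupling is continuous in the dual variable
  -- and vanishes at `(C w, w)`.
  obtain ⟨w, -, φ, hφ, hw⟩ := hK.tendsto_subseq (x := fun k : ℕ => P (z k))
    fun k => hmem k k.cast_nonneg
  have hτ : Tendsto (fun k => ((φ k : ℕ) : ℝ)) atTop atTop :=
    tendsto_natCast_atTop_atTop.comp hφ.tendsto_atTop
  have hx : Tendsto (fun k => C (z (φ k))) atTop (𝓝 (C w)) := by
    have h := (hC.continuous.tendsto w).comp hw
    simpa only [Function.comp_def, hCP] using h
  have hle : ∀ v ∈ vectorSpan ℝ Ω, inner ℝ (U (C w)) v ≤ 0 := fun v hv => by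
    obtain ⟨B₁, hB₁⟩ := hF.inner_dual_bounded hC hα hβ hγ hint hVS hv
    obtain ⟨B₂, hB₂⟩ := hF.inner_dual_bounded hC hα hβ hγ hint hVS (neg_mem hv)
    refine hF.inner_nonpos_of_tendsto hC hβ hγ hU hgap hτ (hC.mem w) hx
      (B := max B₁ B₂) fun t ht => ?_
    have h2 := hB₂ t ht
    rw [inner_neg_left] at h2
    rw [abs_le]
    exact ⟨by linarith [le_max_right B₁ B₂], (hB₁ t ht).trans (le_max_left _ _)⟩
  have hw0 : ∀ y ∈ Ω, inner ℝ (U (C w)) (y - C w) = 0 := fun y hy => by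
    have hv : y - C w ∈ vectorSpan ℝ Ω := vsub_mem_vectorSpan ℝ hy (hC.mem w)
    have h2 := hle _ (neg_mem hv)
    rw [inner_neg_right] at h2
    exact le_antisymm (hle _ hv) (by linarith)
  refine ⟨w, hw0, ?_⟩
  have hVSw := hrest w hw0
  have hξ : Tendsto (fun k => ξ (φ k)) atTop (𝓝 (C w)) := by
    simpa using hx.sub (hgap.comp hτ)
  have hLsub : Tendsto (fun k => lyapunov f C α β γ (C w) (z (φ k)) (ξ (φ k))) atTop (𝓝 0) := by
    have h1 := ((hC.continuous_coupling (C w)).tendsto w).comp hw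
    have h2 := (((hξ.sub_const (C w)).norm).pow 2).const_mul (α / (2 * β))
    have h3 := (h1.const_mul γ⁻¹).add h2
    rw [IsChoiceMap.coupling_self] at h3
    simpa [Function.comp_def, lyapunov, P, hC.coupling_starProjection (hC.mem w)] using h3
  have hcoup : Tendsto (fun t => coupling f C (C w) (P (z t))) atTop (𝓝 0) := by
    rw [Metric.tendsto_atTop]
    intro η hη
    obtain ⟨k, hk⟩ := (hLsub.eventually (gt_mem_nhds (show 0 < γ⁻¹ * η by positivity))).exists
    refine ⟨φ k, fun t ht => ?_⟩
    have h1 := hC.coupling_nonneg (hC.mem w) (z t)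
    have h2 := hF.lyapunov_le hC hα hβ hγ hVSw (φ k).cast_nonneg ht
    have h3 := coupling_le_lyapunov (f := f) (C := C) hα hβ hγ (C w) (z t) (ξ t)
    have h4 := mul_lt_mul_of_pos_left (h2.trans_lt hk) hγ
    rw [mul_inv_cancel_left₀ hγ.ne'] at h4
    rw [hC.coupling_starProjection (hC.mem w), Real.dist_0_eq_abs, abs_of_nonneg h1]
    exact h3.trans_lt h4
  simp only [← hCP]
  refine (hK.image hC.continuous).tendsto_nhds_of_unique_mapClusterPt
    ((eventually_ge_atTop 0).mono fun t ht => mem_image_of_mem C (hmem t ht)) fun y _ hy => ?_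
  -- An ultrafilter lifts a cluster point `y` of the state to a dual limit `w'` with `y = C w'`;
  -- zero coupling of `C w` with `w'` then forces `C w = C w'`.
  obtain ⟨F, hF, hFy⟩ := mapClusterPt_iff_ultrafilter.1 hy
  have hev : ∀ᶠ t in (F : Filter ℝ), P (z t) ∈ Metric.closedBall (0 : H) R :=
    ((eventually_ge_atTop 0).mono hmem).filter_mono hF
  obtain ⟨w', -, hw'⟩ := hK.ultrafilter_le_nhds (F.map fun t => P (z t)) (le_principal_iff.2 hev)
  have hFw : Tendsto (fun t => P (z t)) F (𝓝 w') := hw'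
  have h1 := tendsto_nhds_unique hFy ((hC.continuous.tendsto w').comp hFw)
  have h2 := tendsto_nhds_unique (hcoup.mono_left hF)
    (((hC.continuous_coupling (C w)).tendsto w').comp hFw)
  rw [h1, hC.eq_of_coupling_eq_zero (hC.mem w) h2.symm]

end IsMirrorFlow
end Flow

/-! ### Existence, uniqueness and continuity of maximisers. -/

section ChoiceMapExistence

variable {H : Type*} [NormedAddCommGroup H] [InnerProductSpace ℝ H]
  {Ω : Set H} {f : H → ℝ}

lemma lowerSemicontinuousOn_of_isClosed_epigraph {V : Type*} [TopologicalSpace V] {Ω : Set V}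
    {f : V → ℝ} (hepi : IsClosed {q : V × ℝ | q.1 ∈ Ω ∧ f q.1 ≤ q.2}) : LowerSemicontinuousOn f Ω := by
  intro x hx c hc
  have hcl : IsClosed {y : V | y ∈ Ω ∧ f y ≤ c} :=
    hepi.preimage (continuous_id.prodMk (continuous_const (y := c)))
  filter_upwards [nhdsWithin_le_nhds (hcl.isOpen_compl.mem_nhds
    (show x ∉ {y : V | y ∈ Ω ∧ f y ≤ c} from fun h => not_lt.2 h.2 hc)), self_mem_nhdsWithin]
    with y hy hyΩ
  exact not_le.1 fun h => hy ⟨hyΩ, h⟩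

/-- The radius is uniform over a ball of `z`, which keeps maximisers locally bounded. -/
lemma exists_norm_le_sub_inner
    (hsc : ∀ M : ℝ, ∀ᶠ x in Bornology.cobounded H, x ∈ Ω → M * ‖x‖ ≤ f x) (r : ℝ) :
    ∃ R, ∀ z, ‖z‖ ≤ r → ∀ y ∈ Ω, R ≤ ‖y‖ → ‖y‖ ≤ f y - inner ℝ y z := by
  obtain ⟨R, -, hR⟩ := (hasBasis_cobounded_norm (E := H)).eventually_iff.1 (hsc (r + 1))
  refine ⟨R, fun z hz y hy hRy => ?_⟩
  have h1 : (r + 1) * ‖y‖ ≤ f y := hR hRy hy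
  have h2 := real_inner_le_norm y z
  have h3 : ‖y‖ * ‖z‖ ≤ ‖y‖ * r := by gcongr
  linarith

lemma exists_maximizer [FiniteDimensional ℝ H] (hne : Ω.Nonempty) (hΩ : IsClosed Ω)
    (hepi : IsClosed {q : H × ℝ | q.1 ∈ Ω ∧ f q.1 ≤ q.2})
    (hsc : ∀ M : ℝ, ∀ᶠ x in Bornology.cobounded H, x ∈ Ω → M * ‖x‖ ≤ f x) (z : H) :
    ∃ x ∈ Ω, ∀ y ∈ Ω, inner ℝ y z - f y ≤ inner ℝ x z - f x := by
  obtain ⟨y₀, hy₀⟩ := hne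
  obtain ⟨R, hR⟩ := exists_norm_le_sub_inner hsc ‖z‖
  set ρ := max R (max ‖y₀‖ (f y₀ - inner ℝ y₀ z))
  have hK : IsCompact (Ω ∩ Metric.closedBall 0 ρ) := (isCompact_closedBall _ _).inter_left hΩ
  have hy₀K : y₀ ∈ Ω ∩ Metric.closedBall 0 ρ := ⟨hy₀, by simp [ρ]⟩
  have hlsc : LowerSemicontinuousOn (fun y => f y + -inner ℝ y z) (Ω ∩ Metric.closedBall 0 ρ) :=
    ((lowerSemicontinuousOn_of_isClosed_epigraph hepi).mono inter_subset_left).add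
      ((show Continuous fun y => -inner ℝ y z by fun_prop).lowerSemicontinuous.lowerSemicontinuousOn
        _)
  obtain ⟨x, hx, hmin⟩ := hlsc.exists_isMinOn ⟨y₀, hy₀K⟩ hK
  refine ⟨x, hx.1, fun y hy => ?_⟩
  by_cases hyρ : ‖y‖ ≤ ρ
  · have h : f x + -inner ℝ x z ≤ f y + -inner ℝ y z := hmin ⟨hy, by simpa using hyρ⟩
    linarith
  · have h : f x + -inner ℝ x z ≤ f y₀ + -inner ℝ y₀ z := hmin hy₀K
    have h1 := hR z le_rfl y hy ((le_max_left _ _).trans (not_le.1 hyρ).le)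
    have h2 : f y₀ - inner ℝ y₀ z ≤ ρ := (le_max_right _ _).trans (le_max_right _ _)
    linarith [not_le.1 hyρ]

lemma maximizer_unique (hconv : StrictConvexOn ℝ Ω f) {x y z : H} (hx : x ∈ Ω) (hy : y ∈ Ω)
    (hxm : ∀ w ∈ Ω, inner ℝ w z - f w ≤ inner ℝ x z - f x)
    (hym : ∀ w ∈ Ω, inner ℝ w z - f w ≤ inner ℝ y z - f y) : x = y := by
  by_contra hxy
  have h1 := hconv.2 hx hy hxy (one_half_pos (α := ℝ)) (one_half_pos (α := ℝ)) (by norm_num)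
  have h2 := hxm _ (hconv.1 hx hy (one_half_pos (α := ℝ)).le (one_half_pos (α := ℝ)).le
    (by norm_num))
  have h3 := hxm y hy
  have h4 := hym x hx
  simp only [inner_add_left, inner_smul_left, conj_trivial, smul_eq_mul] at h1 h2
  linarith

/-- Continuity holds because maximisers are locally bounded and each of their cluster points is
again a maximiser, hence the unique one. -/
lemma isChoiceMap_of_maximizer [FiniteDimensional ℝ H]
    (hepi : IsClosed {q : H × ℝ | q.1 ∈ Ω ∧ f q.1 ≤ q.2}) (hconv : StrictConvexOn ℝ Ω f)
    (hsc : ∀ M : ℝ, ∀ᶠ x in Bornology.cobounded H, x ∈ Ω → M * ‖x‖ ≤ f x) {C : H → H}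
    (hC : ∀ z, C z ∈ Ω ∧ ∀ y ∈ Ω, inner ℝ y z - f y ≤ inner ℝ (C z) z - f (C z)) :
    IsChoiceMap Ω f C where
  mem z := (hC z).1
  le z := (hC z).2
  unique z x hx hmax := maximizer_unique hconv hx (hC z).1 hmax (hC z).2
  continuous := by
    refine continuous_iff_continuousAt.2 fun z => ?_
    obtain ⟨R, hR⟩ := exists_norm_le_sub_inner hsc (‖z‖ + 1)
    have hy₀ := (hC z).1
    set y₀ := C z
    set ρ := max R (f y₀ + ‖y₀‖ * (‖z‖ + 1))
    have hz' : ∀ᶠ w in 𝓝 z, ‖w‖ ≤ ‖z‖ + 1 :=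
      (continuous_norm.tendsto z).eventually (ge_mem_nhds (lt_add_one _))
    refine (isCompact_closedBall (0 : H) ρ).tendsto_nhds_of_unique_mapClusterPt
      (hz'.mono fun w hw => ?_) fun y _ hy => ?_
    · rw [mem_closedBall_zero_iff]
      by_contra! h
      have h1 := hR w hw (C w) (hC w).1 ((le_max_left _ _).trans h.le)
      have h2 := (hC w).2 y₀ hy₀
      have h3 : f y₀ + ‖y₀‖ * (‖z‖ + 1) ≤ ρ := le_max_right _ _
      have h4 := neg_le_of_abs_le (abs_real_inner_le_norm y₀ w)
      have h5 : ‖y₀‖ * ‖w‖ ≤ ‖y₀‖ * (‖z‖ + 1) := by gcongr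
      linarith
    · obtain ⟨F, hF, hFy⟩ := mapClusterPt_iff_ultrafilter.1 hy
      have hFz : Tendsto id (F : Filter H) (𝓝 z) := hF
      -- Since `f` need not be continuous, the limit is taken of points of the closed epigraph whose
      -- heights come from optimality against `v`.
      have key : ∀ v ∈ Ω, y ∈ Ω ∧ f y ≤ inner ℝ y z - inner ℝ v z + f v := fun v hv => by
        have h := hFy.prodMk_nhds
          (((hFy.inner hFz).sub (tendsto_const_nhds.inner hFz)).add_const (f v)
            : Tendsto (fun w => inner ℝ (C w) (id w) - inner ℝ v (id w) + f v) _ _)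
        exact hepi.mem_of_tendsto h (Eventually.of_forall fun w =>
          ⟨(hC w).1, by simp only [id]; linarith [(hC w).2 v hv]⟩)
      exact maximizer_unique hconv (key y₀ hy₀).1 hy₀
        (fun v hv => by linarith [(key v hv).2]) (hC z).2

/-- The objective is separable. For uniqueness, equal sums of termwise ordered summands force
equality in each coordinate. -/
lemma IsChoiceMap.pi {ι : Type*} [Fintype ι] {V : ι → Type*} [∀ i, NormedAddCommGroup (V i)]
    [∀ i, InnerProductSpace ℝ (V i)] {Ω : ∀ i, Set (V i)} {f : ∀ i, V i → ℝ}
    {C : ∀ i, V i → V i} (hC : ∀ i, IsChoiceMap (Ω i) (f i) (C i)) :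
    IsChoiceMap {x : PiLp 2 V | ∀ i, x i ∈ Ω i} (fun x => ∑ i, f i (x i))
      (fun z => WithLp.toLp 2 fun i => C i (z i)) where
  continuous := by
    have := fun i => (hC i).continuous
    fun_prop
  mem z i := (hC i).mem _
  le z y hy := by
    simp only [PiLp.inner_apply, ← Finset.sum_sub_distrib]
    exact Finset.sum_le_sum fun i _ => (hC i).le (z i) (y i) (hy i)
  unique z x hx hmax := by
    have h := hmax (WithLp.toLp 2 fun i => C i (z i)) fun i => (hC i).mem _
    simp only [PiLp.inner_apply, ← Finset.sum_sub_distrib] at h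
    have hle := fun i (_ : i ∈ Finset.univ) => (hC i).le (z i) (x i) (hx i)
    have heq := (Finset.sum_eq_sum_iff_of_le hle).1 (le_antisymm (Finset.sum_le_sum hle) h)
    ext1 i
    refine (hC i).unique (z i) (x i) (hx i) fun y hy => ?_
    rw [heq i (Finset.mem_univ i)]
    exact (hC i).le (z i) y hy

end ChoiceMapExistence

/-! ### Steepness keeps maximisers off the boundary. -/

section Steep

variable {H : Type*} [NormedAddCommGroup H] [InnerProductSpace ℝ H] [CompleteSpace H]
  {Ω : Set H} {f : H → ℝ}

lemma add_inner_gradient_le_of_convexOn (hconv : ConvexOn ℝ Ω f) {x y g : H} (hx : x ∈ Ω)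
    (hy : y ∈ Ω) (hg : HasGradientAt f g x) : f x + inner ℝ g (y - x) ≤ f y := by
  have h1 : ConvexOn ℝ (AffineMap.lineMap x y ⁻¹' Ω) (f ∘ AffineMap.lineMap (k := ℝ) x y) :=
    hconv.comp_affineMap _
  have h2 : HasDerivAt (f ∘ AffineMap.lineMap (k := ℝ) x y) (inner ℝ g (y - x)) 0 := by
    have h3 : HasFDerivAt f (InnerProductSpace.toDual ℝ H g)
        (AffineMap.lineMap (k := ℝ) x y (0 : ℝ)) := by
      rw [AffineMap.lineMap_apply_zero]; exact hg.hasFDerivAt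
    simpa using h3.comp_hasDerivAt (0 : ℝ) AffineMap.hasDerivAt_lineMap
  have h4 := h1.le_slope_of_hasDerivAt (x := 0) (y := 1) (by simpa) (by simpa) one_pos h2
  simp [slope_def_field] at h4
  linarith

/-- A maximiser of `⟨·, z⟩ - ε f` lies in the interior, if `f` is convex and steep. -/
lemma mem_interior_of_steep (hconv : ConvexOn ℝ Ω f) (hint : (interior Ω).Nonempty)
    (hd : ∀ x ∈ interior Ω, DifferentiableAt ℝ f x)
    (hsteep : ∀ (u : ℕ → H) (b : H), (∀ i, u i ∈ interior Ω) → b ∈ frontier Ω →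
      Tendsto u atTop (𝓝 b) → Tendsto (fun i => ‖gradient f (u i)‖) atTop atTop)
    {ε : ℝ} (hε : 0 < ε) {x z : H} (hx : x ∈ Ω)
    (hmax : ∀ y ∈ Ω, inner ℝ y z - ε * f y ≤ inner ℝ x z - ε * f x) : x ∈ interior Ω := by
  by_contra hxi
  obtain ⟨x₀, hx₀⟩ := hint
  obtain ⟨r, hr, hball⟩ : ∃ r > 0, ∀ y, ‖y - x₀‖ ≤ r → y ∈ Ω ∧ f y ≤ f x₀ + 1 := by
    have h1 : ∀ᶠ y in 𝓝 x₀, f y < f x₀ + 1 :=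
      (hd x₀ hx₀).continuousAt.tendsto.eventually (gt_mem_nhds (lt_add_one _))
    obtain ⟨r, hr, h⟩ := Metric.nhds_basis_closedBall.eventually_iff.1
      (h1.and (mem_interior_iff_mem_nhds.1 hx₀))
    exact ⟨r, hr, fun y hy => by
      have := h (show y ∈ Metric.closedBall x₀ r by rwa [mem_closedBall_iff_norm])
      exact ⟨this.2, this.1.le⟩⟩
  set t : ℕ → ℝ := fun k => 1 / ((k : ℝ) + 1)
  have ht0 : ∀ k, 0 < t k := fun k => Nat.one_div_pos_of_nat
  have ht1 : ∀ k, t k ≤ 1 := fun k => by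
    simp only [t]; rw [div_le_one (by positivity)]; linarith [k.cast_nonneg (α := ℝ)]
  set d := x₀ - x
  -- Interior points tending to the supposed boundary maximiser, where steepness makes the gradients
  -- blow up.
  set u : ℕ → H := fun k => x + t k • d
  have hu : ∀ k, u k ∈ interior Ω := fun k =>
    hconv.1.add_smul_sub_mem_interior hx hx₀ ⟨ht0 k, ht1 k⟩
  have hux : Tendsto u atTop (𝓝 x) := by
    have := (tendsto_one_div_add_atTop_nhds_zero_nat (𝕜 := ℝ)).smul_const d |>.const_add x
    simpa [u, t] using this
  have hlim := hsteep u x hu ⟨subset_closure hx, hxi⟩ hux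
  -- the gradients along the segment are bounded
  set K := (f x₀ + 1 - f x + 2 * (‖d‖ * ‖z‖ / ε)) / r
  obtain ⟨k, hk⟩ := (hlim.eventually_gt_atTop K).exists
  set g := gradient f (u k)
  have hg : HasGradientAt f g (u k) := (hd _ (hu k)).hasGradientAt
  have hdz := neg_le_of_abs_le (abs_real_inner_le_norm d z)
  have hD : ‖d‖ * ‖z‖ = ε * (‖d‖ * ‖z‖ / ε) := by field_simp
  set D := ‖d‖ * ‖z‖ / ε
  have hD0 : 0 ≤ D := by positivity
  have hfu : f x - t k * D ≤ f (u k) := by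
    have h := hmax (u k) (interior_subset (hu k))
    simp only [u, inner_add_left, inner_smul_left, conj_trivial] at h
    have h2 : t k * -(ε * D) ≤ t k * inner ℝ d z := by
      rw [← hD]; exact mul_le_mul_of_nonneg_left hdz (ht0 k).le
    have h3 : ε * (f x - t k * D) ≤ ε * f (u k) := by simp only [u]; linarith
    exact le_of_mul_le_mul_left h3 hε
  -- Maximality of `x` bounds `f (u k)` below; the gradient inequality from `u k` to `x` turns this
  -- into a slope bound.
  have hgd : -D ≤ inner ℝ g d := by
    have h := add_inner_gradient_le_of_convexOn hconv (interior_subset (hu k)) hx hg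
    have e : x - u k = -(t k • d) := by simp [u]
    rw [e, inner_neg_right, inner_smul_right] at h
    have h3 : t k * (-D) ≤ t k * inner ℝ g d := by linarith
    exact le_of_mul_le_mul_left h3 (ht0 k)
  -- The gradient inequality is tested at the point of the ball around `x₀` farthest in the
  -- direction of `g`, where `f ≤ f x₀ + 1`.
  have hgn : r * ‖g‖ ≤ f x₀ + 1 - f x + 2 * D := by
    rcases eq_or_ne g 0 with h0 | h0
    · have hKneg := add_inner_gradient_le_of_convexOn hconv (interior_subset (hu k))
        (interior_subset hx₀) hg
      rw [h0, inner_zero_left] at hKneg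
      rw [h0, norm_zero, mul_zero]
      nlinarith [ht1 k]
    · have hn : 0 < ‖g‖ := norm_pos_iff.2 h0
      obtain ⟨hyΩ, hy⟩ := hball (x₀ + (r / ‖g‖) • g) (by
        rw [add_sub_cancel_left, norm_smul, Real.norm_of_nonneg (by positivity),
          div_mul_cancel₀ _ hn.ne'])
      have h := add_inner_gradient_le_of_convexOn hconv (interior_subset (hu k)) hyΩ hg
      have e : x₀ + (r / ‖g‖) • g - u k = (1 - t k) • d + (r / ‖g‖) • g := by
        simp only [u, d]; module
      rw [e, inner_add_right, inner_smul_right, inner_smul_right, real_inner_self_eq_norm_sq] at h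
      have e2 : r / ‖g‖ * ‖g‖ ^ 2 = r * ‖g‖ := by field_simp
      rw [e2] at h
      have h5 : (1 - t k) * (-D) ≤ (1 - t k) * inner ℝ g d :=
        mul_le_mul_of_nonneg_left hgd (by linarith [ht1 k])
      linarith
  have : r * K = f x₀ + 1 - f x + 2 * D := by
    rw [mul_comm]; exact div_mul_cancel₀ _ hr.ne'
  nlinarith

end Steep

/-! ### Regularizers induce choice maps. -/

section Regularizer

variable {k : ℕ} {Ω : Set (E k)} {ϑ : E k → EReal}

lemma IsRegularizer.mem_iff (hϑ : IsRegularizer Ω ϑ) {x : E k} : x ∈ Ω ↔ ϑ x < ⊤ := by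
  rw [← hϑ.domain]; rfl

lemma IsRegularizer.coe_toReal (hϑ : IsRegularizer Ω ϑ) {x : E k} (hx : x ∈ Ω) :
    ((ϑ x).toReal : EReal) = ϑ x :=
  EReal.coe_toReal (hϑ.mem_iff.1 hx).ne (hϑ.ne_bot x)

lemma IsRegularizer.isClosed_epigraph_toReal (hϑ : IsRegularizer Ω ϑ) {ε : ℝ} (hε : 0 < ε) :
    IsClosed {q : E k × ℝ | q.1 ∈ Ω ∧ ε * (ϑ q.1).toReal ≤ q.2} := by
  have h : Continuous fun q : E k × ℝ => (q.1, q.2 / ε) := by fun_prop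
  convert hϑ.closed.preimage h using 1
  ext q
  simp only [mem_ofPred_eq, mem_preimage]
  constructor
  · rintro ⟨hq, hle⟩
    rw [← hϑ.coe_toReal hq, EReal.coe_le_coe_iff, le_div_iff₀ hε]
    linarith
  · intro hle
    have hq : q.1 ∈ Ω := hϑ.mem_iff.2 (hle.trans_lt (EReal.coe_lt_top _))
    rw [← hϑ.coe_toReal hq, EReal.coe_le_coe_iff, le_div_iff₀ hε] at hle
    exact ⟨hq, by linarith⟩

lemma IsRegularizer.eventually_mul_norm_le (hϑ : IsRegularizer Ω ϑ) (hsc : IsSupercoercive ϑ)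
    {ε : ℝ} (hε : 0 < ε) (M : ℝ) :
    ∀ᶠ x in Bornology.cobounded (E k), x ∈ Ω → M * ‖x‖ ≤ ε * (ϑ x).toReal := by
  filter_upwards [hsc (M / ε)] with x hx hxΩ
  rw [← hϑ.coe_toReal hxΩ, EReal.coe_le_coe_iff, div_mul_eq_mul_div, div_le_iff₀ hε] at hx
  linarith

/-- Far from the origin `ϑ` is `⊤`. -/
lemma IsRegularizer.isSupercoercive_of_isCompact (hϑ : IsRegularizer Ω ϑ) (hΩ : IsCompact Ω) :
    IsSupercoercive ϑ := fun M => by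
  filter_upwards [Bornology.isBounded_def.1 hΩ.isBounded] with x hx
  have h : ϑ x = ⊤ := not_lt_top_iff.1 fun h => hx (hϑ.mem_iff.2 h)
  rw [h]
  exact le_top

lemma isChoiceMap_mirrorMap (hϑ : IsRegularizer Ω ϑ) (hne : Ω.Nonempty) (hΩ : IsClosed Ω)
    (hconv : StrictConvexOn ℝ Ω fun x => (ϑ x).toReal) (hsc : IsSupercoercive ϑ)
    {ε : ℝ} (hε : 0 < ε) :
    IsChoiceMap Ω (fun x => ε * (ϑ x).toReal) (mirrorMap Ω ϑ ε) := by
  have hepi := hϑ.isClosed_epigraph_toReal hε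
  have hco := hϑ.eventually_mul_norm_le hsc hε
  have hconv' : StrictConvexOn ℝ Ω fun x => ε * (ϑ x).toReal := by
    refine ⟨hconv.1, fun x hx y hy hxy a b ha hb hab => ?_⟩
    have h := mul_lt_mul_of_pos_left (hconv.2 hx hy hxy ha hb hab) hε
    simp only [smul_eq_mul] at h ⊢
    linarith
  refine isChoiceMap_of_maximizer hepi hconv' hco fun z => ?_
  have hex : ∃ x, x ∈ Ω ∧ IsMaxOn (fun y => inner ℝ y z - ε * (ϑ y).toReal) Ω x := by
    obtain ⟨x, hx, hmax⟩ := exists_maximizer hne hΩ hepi hco z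
    exact ⟨x, hx, hmax⟩
  have h := Classical.epsilon_spec hex
  exact ⟨h.1, fun y hy => h.2 hy⟩

end Regularizer

/-! ### Pseudo-gradients and transfer of the flow to the game. -/

namespace ConcaveGame

variable {N : ℕ} {n : Fin N → ℕ} (G : ConcaveGame N n)

/-- Expressing the partial gradient through the joint derivative yields continuity of the
pseudo-gradient. -/
lemma hasGradientAt_payoff {x : Profile n} {p : Fin N}
    (h : DifferentiableAt ℝ (G.payoff p) x) :
    HasGradientAt (fun y : E (n p) => G.payoff p (Function.update x p y))
      ((InnerProductSpace.toDual ℝ (E (n p))).symm ((fderiv ℝ (G.payoff p) x).comp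
        (ContinuousLinearMap.pi (Pi.single p (ContinuousLinearMap.id ℝ (E (n p))))))) (x p) := by
  rw [hasGradientAt_iff_hasFDerivAt, LinearIsometryEquiv.apply_symm_apply]
  have h1 : HasFDerivAt (G.payoff p) (fderiv ℝ (G.payoff p) x) (Function.update x p (x p)) := by
    rw [Function.update_eq_self]; exact h.hasFDerivAt
  exact h1.comp (x p) (hasFDerivAt_update x (x p))

lemma differentiableAt_payoff (p : Fin N) {x : Profile n} (hx : x ∈ G.profiles) :
    DifferentiableAt ℝ (G.payoff p) x := by
  obtain ⟨O, hO, hsub, hsm⟩ := G.smooth p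
  exact (hsm.differentiableOn one_ne_zero).differentiableAt (hO.mem_nhds (hsub hx))

lemma continuousOn_pseudoGradient : ContinuousOn G.pseudoGradient G.profiles := by
  refine continuousOn_pi.2 fun p => ?_
  obtain ⟨O, hO, hsub, hsm⟩ := G.smooth p
  have h1 : ContinuousOn (fun x => (InnerProductSpace.toDual ℝ (E (n p))).symm
      ((fderiv ℝ (G.payoff p) x).comp
        (ContinuousLinearMap.pi (Pi.single p (ContinuousLinearMap.id ℝ (E (n p)))))))
      G.profiles := by
    have h2 := (hsm.continuousOn_fderiv_of_isOpen hO le_rfl).mono hsub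
    exact (InnerProductSpace.toDual ℝ (E (n p))).symm.continuous.comp_continuousOn
      (h2.clm_comp continuousOn_const)
  exact h1.congr fun x hx => (G.hasGradientAt_payoff (G.differentiableAt_payoff p hx)).gradient

/-- Testing unilateral deviations gives each player's first-order condition, which concavity makes
sufficient. -/
lemma isNash_of_dot_pseudoGradient_eq_zero {x : Profile n} (hx : x ∈ G.profiles)
    (h : ∀ y ∈ G.profiles, dot (G.pseudoGradient x) (y - x) = 0) : G.IsNash x := by
  refine ⟨hx, fun p y hy => ?_⟩
  have hyx : Function.update x p y ∈ G.profiles := by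
    intro q _
    rcases eq_or_ne q p with rfl | hq
    · simpa using hy
    · simpa [hq] using hx q (mem_univ q)
  have h1 : inner ℝ (G.pseudoGradient x p) (y - x p) = 0 := by
    have := h _ hyx
    rw [dot, Finset.sum_eq_single p (fun q _ hq => by simp [hq]) (by simp)] at this
    simpa using this
  have hg := G.hasGradientAt_payoff (G.differentiableAt_payoff p hx)
  have hgrad : HasGradientAt (fun y : E (n p) => G.payoff p (Function.update x p y))
      (G.pseudoGradient x p) (x p) := by
    rw [pseudoGradient, hg.gradient]; exact hg
  have hneg : HasGradientAt (-fun y : E (n p) => G.payoff p (Function.update x p y))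
      (-(G.pseudoGradient x p)) (x p) := by
    rw [hasGradientAt_iff_hasFDerivAt, map_neg]; exact hgrad.hasFDerivAt.neg
  have h2 := add_inner_gradient_le_of_convexOn (G.concave p x hx).neg
    (hx p (mem_univ p)) hy hneg
  simp only [Pi.neg_apply, Function.update_eq_self, inner_neg_left, h1] at h2
  linarith

/-- The Euclidean space of strategy profiles. -/
abbrev EuclideanProfile {N : ℕ} (n : Fin N → ℕ) := PiLp 2 fun p => E (n p)

/-- The identification of profiles with points of the Euclidean space of profiles. -/
abbrev toEuclidean {N : ℕ} (n : Fin N → ℕ) : Profile n ≃L[ℝ] EuclideanProfile n :=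
  (PiLp.continuousLinearEquiv 2 ℝ fun p => E (n p)).symm

lemma inner_toEuclidean (x y : Profile n) :
    inner ℝ (toEuclidean n x) (toEuclidean n y) = dot x y := by
  simp [PiLp.inner_apply, dot]

lemma toEuclidean_image_profiles :
    (toEuclidean n).symm '' {x : EuclideanProfile n | ∀ p, x p ∈ G.Ω p} = G.profiles := by
  ext x
  constructor
  · rintro ⟨y, hy, rfl⟩ p _
    exact hy p
  · intro hx
    exact ⟨toEuclidean n x, fun p => hx p (mem_univ p),
      (toEuclidean n).symm_apply_apply x⟩

/-- Convergence of the second-order mirror descent dynamics for strictly convex, supercoercive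
regularizers, if all rest states are variationally stable. -/
theorem tendsto_mirror_of_isRestState_stable {xs : Profile n} (hxs : xs ∈ G.relInterior)
    (hVS : G.IsMereVSS xs) {ϑ : (p : Fin N) → E (n p) → EReal}
    (hϑ : ∀ p, IsRegularizer (G.Ω p) (ϑ p))
    (hconv : ∀ p, StrictConvexOn ℝ (G.Ω p) fun x => (ϑ p x).toReal)
    (hsc : ∀ p, IsSupercoercive (ϑ p)) {α β γ ε : ℝ} (hα : 0 < α) (hβ : 0 < β) (hγ : 0 < γ)
    (hε : 0 < ε) {z ξ : ℝ → Profile n} (hsol : G.IsMD2Solution ϑ α β γ ε z ξ)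
    (hrest : ∀ x, G.IsRestState ϑ ε x →
      ∀ y ∈ G.profiles, dot (G.pseudoGradient y) (y - x) ≤ 0) :
    ∃ x, G.IsRestState ϑ ε x ∧ Tendsto (fun t => G.mirror ϑ ε (z t)) atTop (𝓝 x) := by
  -- `Profile n` carries the sup norm, so the flow is transported to an inner product space by a
  -- linear homeomorphism.
  set e := toEuclidean n
  have hC := IsChoiceMap.pi fun p => isChoiceMap_mirrorMap (hϑ p) (G.nonempty p) (G.closed p)
    (hconv p) (hsc p) hε
  set Ω : Set (EuclideanProfile n) := {x | ∀ p, x p ∈ G.Ω p}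
  set C : EuclideanProfile n → EuclideanProfile n := fun x => e (G.mirror ϑ ε (e.symm x))
  set U : EuclideanProfile n → EuclideanProfile n := fun x => e (G.pseudoGradient (e.symm x))
  have hmem : ∀ {x}, x ∈ Ω → e.symm x ∈ G.profiles := fun hx p _ => hx p
  have hmem' : ∀ {x}, x ∈ G.profiles → e x ∈ Ω := fun hx p => hx p (mem_univ p)
  have hinner : ∀ x y w : EuclideanProfile n, inner ℝ (U x) (y - w) =
      dot (G.pseudoGradient (e.symm x)) (e.symm y - e.symm w) := fun x y w => by
    rw [← inner_toEuclidean, map_sub, e.apply_symm_apply, e.apply_symm_apply]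
  have hF : IsMirrorFlow C U α β γ (fun t => e (z t)) fun t => e (ξ t) := by
    refine ⟨fun t ht => ?_, fun t ht => ?_⟩
    · have h := e.hasFDerivAt.comp_hasDerivWithinAt t (hsol t ht).1
      simpa [C, U, Function.comp_def] using h
    · have h := e.hasFDerivAt.comp_hasDerivWithinAt t (hsol t ht).2
      simpa [C, Function.comp_def] using h
  have hU : ContinuousOn U Ω := e.continuous.comp_continuousOn
    (G.continuousOn_pseudoGradient.comp e.symm.continuous.continuousOn fun x hx => hmem hx)
  have hint : ∀ v ∈ vectorSpan ℝ Ω, ∃ s : ℝ, 0 < s ∧ e xs + s • v ∈ Ω := fun v hv => by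
    have hv' : e.symm v ∈ vectorSpan ℝ G.profiles := by
      have h := Submodule.mem_map_of_mem (f := (e.symm : EuclideanProfile n →ₗ[ℝ] Profile n)) hv
      have h2 := (e.symm : EuclideanProfile n →ₗ[ℝ] Profile n).toAffineMap
        |>.map_vectorSpan (s := Ω)
      rw [← G.toEuclidean_image_profiles]
      exact h2 ▸ h
    obtain ⟨s, hs, hmem⟩ := exists_pos_add_smul_mem_of_mem_intrinsicInterior hxs hv'
    exact ⟨s, hs, by simpa using hmem' hmem⟩
  have hrestC : ∀ w, (∀ y ∈ Ω, inner ℝ (U (C w)) (y - C w) = 0) →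
      G.IsRestState ϑ ε (e.symm (C w)) := fun w hw =>
    ⟨⟨e.symm w, by simp [C]⟩, fun y hy => by
      have h := hw (e y) (hmem' hy)
      rwa [hinner, e.symm_apply_apply] at h⟩
  obtain ⟨w, hw, hlim⟩ := hF.tendsto_rest hC hα hβ hγ hU (hmem' hVS.1.1) hint
    (fun y hy => by
      rw [hinner, e.symm_apply_apply]
      exact hVS.2 _ (hmem hy))
    (fun w hw y hy => by
      rw [hinner]
      exact hrest _ (hrestC w hw) _ (hmem hy))
  refine ⟨e.symm (C w), hrestC w hw, ?_⟩
  have h : Tendsto (fun t => e.symm (C (e (z t)))) atTop (𝓝 (e.symm (C w))) :=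
    (e.symm.continuous.tendsto (C w)).comp hlim
  simpa [C, Function.comp_def] using h

end ConcaveGame
end MirrorDescentGame

end

/-! ### The two convergence statements. -/

theorem mainTheorem1 {N : ℕ} {n : Fin N → ℕ} (G : MirrorDescentGame.ConcaveGame N n)
    (hVS : ∀ x ∈ G.relInterior, G.IsNash x → G.IsMereVSS x)
    (hex : ∃ xs ∈ G.relInterior, G.IsMereVSS xs)
    (ϑ : (p : Fin N) → MirrorDescentGame.E (n p) → EReal)
    (hϑ : ∀ p, MirrorDescentGame.IsRegularizer (G.Ω p) (ϑ p))
    (α β γ ε : ℝ) (hα : 0 < α) (hβ : 0 < β) (hγ : 0 < γ) (hε : 0 < ε)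
    (z ξ : ℝ → MirrorDescentGame.Profile n) (hsol : G.IsMD2Solution ϑ α β γ ε z ξ) :
    ((∀ p, ContDiffOn ℝ 2 (fun x => (ϑ p x).toReal) (interior (G.Ω p)) ∧
          MirrorDescentGame.IsLegendre (G.Ω p) (ϑ p) ∧
          MirrorDescentGame.IsSupercoercive (ϑ p)) →
        ∃ xlim ∈ G.relInterior, G.IsMereVSS xlim ∧
          Tendsto (fun t => G.mirror ϑ ε (z t)) atTop (𝓝 xlim)) ∧
    ((∀ p, IsCompact (G.Ω p) ∧
          ∃ ρ : ℝ, 0 < ρ ∧ StrongConvexOn (G.Ω p) ρ fun x => (ϑ p x).toReal) →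
        (∀ x, x ∉ G.relInterior → G.IsRestState ϑ ε x → G.IsMereVSS x) →
        ∃ xlim, G.IsRestState ϑ ε xlim ∧ G.IsMereVSS xlim ∧
          Tendsto (fun t => G.mirror ϑ ε (z t)) atTop (𝓝 xlim)) := by
  obtain ⟨xs, hxs, hxsVS⟩ := hex
  have hinterior : ∀ x ∈ G.relInterior, G.IsRestState ϑ ε x → G.IsMereVSS x := fun x hx hr =>
    hVS x hx (G.isNash_of_dot_pseudoGradient_eq_zero (intrinsicInterior_subset hx) hr.2)
  constructor
  · intro h
    have hstrict := fun p => (h p).2.1.strict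
    -- By steepness the whole range of the mirror map is interior.
    have hrel : ∀ x, G.IsRestState ϑ ε x → x ∈ G.relInterior := by
      rintro x ⟨⟨w, rfl⟩, -⟩
      refine interior_subset_intrinsicInterior ?_
      rw [MirrorDescentGame.ConcaveGame.profiles, interior_pi_set finite_univ]
      intro p _
      have hC := MirrorDescentGame.isChoiceMap_mirrorMap (hϑ p) (G.nonempty p) (G.closed p)
        (hstrict p) (h p).2.2 hε
      exact MirrorDescentGame.mem_interior_of_steep (hstrict p).convexOn
        (h p).2.1.interior_nonempty
        (fun y hy => ((h p).1.differentiableOn two_ne_zero).differentiableAt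
          (isOpen_interior.mem_nhds hy))
        (h p).2.1.steep hε (hC.mem _) (hC.le _)
    obtain ⟨x, hx, hlim⟩ := G.tendsto_mirror_of_isRestState_stable hxs hxsVS hϑ hstrict
      (fun p => (h p).2.2) hα hβ hγ hε hsol fun x hx => (hinterior x (hrel x hx) hx).2
    exact ⟨x, hrel x hx, hinterior x (hrel x hx) hx, hlim⟩
  · intro h hboundary
    have hstable : ∀ x, G.IsRestState ϑ ε x → G.IsMereVSS x := fun x hx => by
      by_cases hr : x ∈ G.relInterior
      · exact hinterior x hr hx
      · exact hboundary x hr hx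
    obtain ⟨x, hx, hlim⟩ := G.tendsto_mirror_of_isRestState_stable hxs hxsVS hϑ
      (fun p => by obtain ⟨ρ, hρ, hs⟩ := (h p).2; exact hs.strictConvexOn hρ)
      (fun p => (hϑ p).isSupercoercive_of_isCompact (h p).1) hα hβ hγ hε hsol
      fun x hx => (hstable x hx).2
    exact ⟨x, hx, hstable x hx, hlim⟩
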